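/- All germs below are germs at $+\infty$ of real valued functions on half-lines. Let $\mathcal C$ be the ring of germs of continuous functions $[a,+\infty)\to\mathbb R$ ($a\in\mathbb R$), and let $\mathcal C^\infty$ be its subring of germs of infinitely differentiable functions $[a,+\infty)\to\mathbb R$ ($a\in\mathbb R$). For germs $g,h$ write $g<_{\mathrm e}h$ if $g(t)<h(t)$ for all sufficiently large $t$. A \emph{Hardy field} is a subring, containing $1$, of the ring of germs of differentiable functions $(a,+\infty)\to\mathbb R$ ($a\in\mathbb R$) that is a field and is closed under differentiation. A Hardy field $H$ that contains (the germs of) all real constants is \emph{Liouville closed} if it is real closed and for every $f\in H$ there are $g\in H$ with $g'=f$ and $z\in H$, $z\neq 0$, with $z'/z=f$. \textbf{Theorem.} Let $H\supseteq\mathbb R$ be a Liouville closed Hardy field, and let $\phi\in\mathcal C$ satisfy $h<_{\mathrm e}\phi$ for all $h\in H$. Then there is a $y\in\mathcal C^\infty$ with $\phi<_{\mathrm e}y$ that generates a Hardy field $H\langle y\rangle$ over $H$; that is, among the Hardy fields that extend $H$ and contain $y$ there is a smallest one, $H\langle y\rangle$. -/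

import Mathlib

namespace HardyFields

open Filter Topology

/-- The ring of germs at `+∞` of real valued functions. A function on a half-line `[a, +∞)` or
`(a, +∞)` has a germ here: that of any of its extensions to `ℝ`. -/
abbrev RGerm : Type := Germ (atTop : Filter ℝ) ℝ

/-- `g <ₑ h`: `g(t) < h(t)` for all sufficiently large `t`. (This is stronger than the strict
order `g < h` of `RGerm`, which only says `g ≤ h` and `g ≠ h`.) -/
def EventuallyLT (g h : RGerm) : Prop := Germ.LiftRel (· < ·) g h

/-- The germs of `r` times continuously differentiable functions `[a, +∞) → ℝ`, where `a` is real
and `r` is a natural number or `∞`. -/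
def smoothGerms (r : ℕ∞) : Set RGerm :=
  {f | ∃ (a : ℝ) (F : ℝ → ℝ), ContDiffOn ℝ r F (Set.Ici a) ∧ f = (F : RGerm)}

/-- The germs of continuous functions `[a, +∞) → ℝ`, where `a` is real. -/
def continuousGerms : Set RGerm :=
  {f | ∃ (a : ℝ) (F : ℝ → ℝ), ContinuousOn F (Set.Ici a) ∧ f = (F : RGerm)}

/-- The germs of differentiable functions `(a, +∞) → ℝ`, where `a` is real. -/
def differentiableGerms : Set RGerm :=
  {f | ∃ (a : ℝ) (F : ℝ → ℝ), DifferentiableOn ℝ F (Set.Ioi a) ∧ f = (F : RGerm)}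

theorem deriv_eventuallyEq {F G : ℝ → ℝ} (h : F =ᶠ[atTop] G) : deriv F =ᶠ[atTop] deriv G := by
  obtain ⟨a, ha⟩ := eventually_atTop.1 h
  filter_upwards [eventually_gt_atTop a] with t ht
  apply Filter.EventuallyEq.deriv_eq
  filter_upwards [Ioi_mem_nhds ht] with s hs
  exact ha s (le_of_lt hs)

/-- The germ of the derivative of a function. It is only used for differentiable germs. -/
noncomputable def germDeriv (f : RGerm) : RGerm :=
  Germ.map' deriv (fun _ _ h => deriv_eventuallyEq h) f

/-- A Hardy field: a subring of the ring of germs of differentiable functions on half-lines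
`(a, +∞)` that is a field and is closed under differentiation. -/
structure IsHardyField (H : Subring RGerm) : Prop where
  differentiable : ∀ f ∈ H, f ∈ differentiableGerms
  isField : IsField H
  deriv_mem : ∀ f ∈ H, germDeriv f ∈ H

/-- `H` contains the (germs of the) real constants. -/
def ContainsReals (H : Subring RGerm) : Prop :=
  ∀ c : ℝ, ((fun _ : ℝ => c : ℝ → ℝ) : RGerm) ∈ H

/-- A Hardy field is Liouville closed if it is real closed, each of its elements has an
antiderivative in it, and each of its elements is the logarithmic derivative `z' / z` of some
nonzero element `z`. -/
structure IsLiouvilleClosed (H : Subring RGerm) : Prop extends IsHardyField H where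
  realClosed : letI : Field H := isField.toField; IsRealClosed H
  exists_antiderivative : ∀ f ∈ H, ∃ g ∈ H, germDeriv g = f
  exists_logDeriv : ∀ f ∈ H, ∃ z ∈ H, z ≠ 0 ∧ germDeriv z = f * z

/-- `y` generates the Hardy field `K = H⟨y⟩` over `H`: among the Hardy fields that extend `H` and
contain `y`, `K` is the smallest one. -/
def GeneratesOver (H : Subring RGerm) (y : RGerm) (K : Subring RGerm) : Prop :=
  IsLeast {L : Subring RGerm | IsHardyField L ∧ H ≤ L ∧ y ∈ L} K

end HardyFields

/-! The germ `y` is the bottom `y 0` of a tower of differentiable germs, all above `φ`, with `y n' =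
y n * y (n + 1)` and with `y (n + 1) ^ m ≤ y n` for every `m`.

Such a tower yields a Hardy field (`exists_generatesOver`). If a germ `z` exceeds a field `K` of
continuous germs, a nonzero polynomial in `z` over `K` stays away from zero by a positive element of
`K`, hence is a unit, and the powers of `z` are cofinal in `K(z)` (`exists_field_extension`). So `y
N, ..., y 0` can be adjoined to `H` in this order, and nonzero elements of `H[y 0, y 1, ...]` are
units. The fractions form a Hardy field, the smallest one because `y (n + 1) = y n' / y n`.

For the tower (`exists_logDeriv_tower`) all levels are built at once. Level `k` is a constant `c k`
until time `k`, and from time `k + 1` on its logarithmic derivative is level `k + 1`. Up to a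
bounded time only finitely many levels move, so this infinite system is solvable (`exists_tower`).
Large constants `c k` lift every level above `φ`, and `tower_logDeriv_le` bounds level `k + 1` by
the squared logarithm of level `k`, which gives the domination of powers. -/

namespace HardyFields

open Filter Topology

/-! ### Fractions with unit denominators -/

section Fractions

variable {A : Type*} [CommRing A]

/-- The subring of all fractions `u / v` with `u, v ∈ R`, where `v` is a unit of the ambient
ring. -/
def fractionSubring (R : Subring A) : Subring A where
  carrier := {g | ∃ u ∈ R, ∃ v ∈ R, IsUnit v ∧ g * v = u}
  mul_mem' := by
    rintro a b ⟨u, hu, v, hv, hv', h⟩ ⟨w, hw, x, hx, hx', h'⟩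
    refine ⟨u * w, R.mul_mem hu hw, v * x, R.mul_mem hv hx, hv'.mul hx', ?_⟩
    rw [← h, ← h']; ring
  one_mem' := ⟨1, R.one_mem, 1, R.one_mem, isUnit_one, one_mul 1⟩
  add_mem' := by
    rintro a b ⟨u, hu, v, hv, hv', h⟩ ⟨w, hw, x, hx, hx', h'⟩
    refine ⟨u * x + w * v, R.add_mem (R.mul_mem hu hx) (R.mul_mem hw hv), v * x,
      R.mul_mem hv hx, hv'.mul hx', ?_⟩
    rw [← h, ← h']; ring
  zero_mem' := ⟨0, R.zero_mem, 1, R.one_mem, isUnit_one, zero_mul 1⟩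
  neg_mem' := by
    rintro a ⟨u, hu, v, hv, hv', h⟩
    refine ⟨-u, R.neg_mem hu, v, hv, hv', ?_⟩
    rw [← h]; ring

theorem le_fractionSubring (R : Subring A) : R ≤ fractionSubring R :=
  fun g hg => ⟨g, hg, 1, R.one_mem, isUnit_one, mul_one g⟩

theorem isField_of_forall_exists_inv [Nontrivial A] {K : Subring A}
    (h : ∀ g ∈ K, g ≠ 0 → ∃ g' ∈ K, g * g' = 1) : IsField K where
  exists_pair_ne := exists_pair_ne K
  mul_comm := mul_comm
  mul_inv_cancel := by
    rintro ⟨g, hg⟩ hne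
    obtain ⟨g', hg', e⟩ := h g hg fun h0 => hne (Subtype.ext h0)
    exact ⟨⟨g', hg'⟩, Subtype.ext e⟩

theorem exists_inv_of_isField {K : Subring A} (hK : IsField K) {g : A} (hg : g ∈ K)
    (hne : g ≠ 0) : ∃ g' ∈ K, g * g' = 1 := by
  obtain ⟨g', e⟩ := hK.mul_inv_cancel (a := ⟨g, hg⟩) fun h0 => hne (congrArg Subtype.val h0)
  exact ⟨g', g'.2, congrArg Subtype.val e⟩

/-- The ring of germs has zero divisors, so denominators must be units. Under `hR` a nonzero
fraction has a unit numerator and can be turned over. -/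
theorem isField_fractionSubring [Nontrivial A] {R : Subring A}
    (hR : ∀ v ∈ R, v ≠ 0 → IsUnit v) : IsField (fractionSubring R) := by
  refine isField_of_forall_exists_inv ?_
  rintro g ⟨u, hu, v, hv, hv', h⟩ hne
  have hu0 : u ≠ 0 := by
    rintro rfl
    exact hne ((hv'.mul_left_eq_zero).1 h)
  have hu' := hR u hu hu0
  obtain ⟨w, hw⟩ := hu'.exists_right_inv
  refine ⟨v * w, ⟨v, hv, u, hu, hu', ?_⟩, ?_⟩
  · linear_combination v * hw
  · rw [← mul_assoc, h, hw]

end Fractions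

/-! ### Continuous and differentiable germs, differentiation -/

section Germs

theorem coe_mem_continuousGerms {F : ℝ → ℝ} :
    (F : RGerm) ∈ continuousGerms ↔ ∀ᶠ t in atTop, ContinuousAt F t := by
  constructor
  · rintro ⟨a, G, hG, e⟩
    obtain ⟨b, hb⟩ := eventually_atTop.1 (Germ.coe_eq.1 e)
    filter_upwards [eventually_gt_atTop a, eventually_gt_atTop b] with t ht ht'
    refine (hG.continuousAt (Ici_mem_nhds ht)).congr ?_
    filter_upwards [Ioi_mem_nhds ht'] with s hs
    exact (hb s (le_of_lt hs)).symm
  · intro h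
    obtain ⟨a, ha⟩ := eventually_atTop.1 h
    exact ⟨a, F, fun t ht => (ha t ht).continuousWithinAt, rfl⟩

theorem coe_mem_differentiableGerms {F : ℝ → ℝ} :
    (F : RGerm) ∈ differentiableGerms ↔ ∀ᶠ t in atTop, DifferentiableAt ℝ F t := by
  constructor
  · rintro ⟨a, G, hG, e⟩
    obtain ⟨b, hb⟩ := eventually_atTop.1 (Germ.coe_eq.1 e)
    filter_upwards [eventually_gt_atTop a, eventually_gt_atTop b] with t ht ht'
    refine (hG.differentiableAt (Ioi_mem_nhds ht)).congr_of_eventuallyEq ?_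
    filter_upwards [Ioi_mem_nhds ht'] with s hs
    exact hb s (le_of_lt hs)
  · intro h
    obtain ⟨a, ha⟩ := eventually_atTop.1 h
    exact ⟨a, F, fun t ht => (ha t (le_of_lt ht)).differentiableWithinAt, rfl⟩

theorem isUnit_coe_iff {F : ℝ → ℝ} : IsUnit (F : RGerm) ↔ ∀ᶠ t in atTop, F t ≠ 0 := by
  constructor
  · intro h
    obtain ⟨g, hg⟩ := h.exists_right_inv
    induction g using Germ.inductionOn with
    | _ G =>
      filter_upwards [Germ.coe_eq.1 (show ((F * G : ℝ → ℝ) : RGerm) = (1 : ℝ → ℝ) from hg)]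
        with t ht h0
      simp [h0] at ht
  · intro h
    refine IsUnit.of_mul_eq_one ((fun t => (F t)⁻¹ : ℝ → ℝ) : RGerm) ?_
    change ((F * (fun t => (F t)⁻¹) : ℝ → ℝ) : RGerm) = (1 : ℝ → ℝ)
    refine Germ.coe_eq.2 ?_
    filter_upwards [h] with t ht
    exact mul_inv_cancel₀ ht

theorem differentiableGerms_subset_continuousGerms : differentiableGerms ⊆ continuousGerms := by
  intro f hf
  induction f using Germ.inductionOn with
  | _ F =>
    rw [coe_mem_continuousGerms]
    exact (coe_mem_differentiableGerms.1 hf).mono fun t h => h.continuousAt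

/-- The germs of continuous functions form a subring. -/
def continuousSubring : Subring RGerm where
  carrier := continuousGerms
  mul_mem' := by
    intro f g hf hg
    induction f, g using Germ.inductionOn₂ with
    | _ F G =>
      change ((F * G : ℝ → ℝ) : RGerm) ∈ _
      rw [coe_mem_continuousGerms] at *
      filter_upwards [hf, hg] with t h h' using h.mul h'
  add_mem' := by
    intro f g hf hg
    induction f, g using Germ.inductionOn₂ with
    | _ F G =>
      change ((F + G : ℝ → ℝ) : RGerm) ∈ _
      rw [coe_mem_continuousGerms] at *
      filter_upwards [hf, hg] with t h h' using h.add h'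
  neg_mem' := by
    intro f hf
    induction f using Germ.inductionOn with
    | _ F =>
      change ((-F : ℝ → ℝ) : RGerm) ∈ _
      rw [coe_mem_continuousGerms] at *
      filter_upwards [hf] with t h using h.neg
  one_mem' := (coe_mem_continuousGerms (F := fun _ => 1)).2 (.of_forall fun _ => continuousAt_const)
  zero_mem' := (coe_mem_continuousGerms (F := fun _ => 0)).2
    (.of_forall fun _ => continuousAt_const)

/-- The germs of differentiable functions form a subring. -/
def differentiableSubring : Subring RGerm where
  carrier := differentiableGerms
  mul_mem' := by
    intro f g hf hg
    induction f, g using Germ.inductionOn₂ with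
    | _ F G =>
      change ((F * G : ℝ → ℝ) : RGerm) ∈ _
      rw [coe_mem_differentiableGerms] at *
      filter_upwards [hf, hg] with t h h' using h.mul h'
  add_mem' := by
    intro f g hf hg
    induction f, g using Germ.inductionOn₂ with
    | _ F G =>
      change ((F + G : ℝ → ℝ) : RGerm) ∈ _
      rw [coe_mem_differentiableGerms] at *
      filter_upwards [hf, hg] with t h h' using h.add h'
  neg_mem' := by
    intro f hf
    induction f using Germ.inductionOn with
    | _ F =>
      change ((-F : ℝ → ℝ) : RGerm) ∈ _
      rw [coe_mem_differentiableGerms] at *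
      filter_upwards [hf] with t h using h.neg
  one_mem' := (coe_mem_differentiableGerms (F := fun _ => 1)).2
    (.of_forall fun t => differentiableAt_const 1)
  zero_mem' := (coe_mem_differentiableGerms (F := fun _ => 0)).2
    (.of_forall fun t => differentiableAt_const 0)

theorem eq_coe_div {G U V : ℝ → ℝ} (hV : IsUnit (V : RGerm))
    (h : (G : RGerm) * (V : RGerm) = (U : RGerm)) : (G : RGerm) = (U / V : ℝ → ℝ) := by
  refine Germ.coe_eq.2 ?_
  filter_upwards [isUnit_coe_iff.1 hV,
    Germ.coe_eq.1 (show ((G * V : ℝ → ℝ) : RGerm) = U from h)] with t ht e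
  exact eq_div_of_mul_eq ht e

theorem fractionSubring_le_continuousSubring {R : Subring RGerm} (hR : R ≤ continuousSubring) :
    fractionSubring R ≤ continuousSubring := by
  rintro g ⟨u, hu, v, hv, hv', h⟩
  have hu' : u ∈ continuousGerms := hR hu
  have hv'' : v ∈ continuousGerms := hR hv
  change g ∈ continuousGerms
  induction g using Germ.inductionOn with
  | _ G =>
  induction u, v using Germ.inductionOn₂ with
  | _ U V =>
    rw [eq_coe_div hv' h, coe_mem_continuousGerms]
    rw [coe_mem_continuousGerms] at hu' hv''
    filter_upwards [hu', hv'', isUnit_coe_iff.1 hv'] with t h1 h2 h3 using h1.div h2 h3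

theorem fractionSubring_le_differentiableSubring {R : Subring RGerm}
    (hR : R ≤ differentiableSubring) : fractionSubring R ≤ differentiableSubring := by
  rintro g ⟨u, hu, v, hv, hv', h⟩
  have hu' : u ∈ differentiableGerms := hR hu
  have hv'' : v ∈ differentiableGerms := hR hv
  change g ∈ differentiableGerms
  induction g using Germ.inductionOn with
  | _ G =>
  induction u, v using Germ.inductionOn₂ with
  | _ U V =>
    rw [eq_coe_div hv' h, coe_mem_differentiableGerms]
    rw [coe_mem_differentiableGerms] at hu' hv''
    filter_upwards [hu', hv'', isUnit_coe_iff.1 hv'] with t h1 h2 h3 using h1.div h2 h3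

theorem germDeriv_add {f g : RGerm} (hf : f ∈ differentiableGerms) (hg : g ∈ differentiableGerms) :
    germDeriv (f + g) = germDeriv f + germDeriv g := by
  induction f, g using Germ.inductionOn₂ with
  | _ F G =>
    rw [coe_mem_differentiableGerms] at *
    change ((deriv (F + G) : ℝ → ℝ) : RGerm) = (deriv F + deriv G : ℝ → ℝ)
    refine Germ.coe_eq.2 ?_
    filter_upwards [hf, hg] with t h h' using deriv_add h h'

theorem germDeriv_mul {f g : RGerm} (hf : f ∈ differentiableGerms) (hg : g ∈ differentiableGerms) :
    germDeriv (f * g) = germDeriv f * g + f * germDeriv g := by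
  induction f, g using Germ.inductionOn₂ with
  | _ F G =>
    rw [coe_mem_differentiableGerms] at *
    change ((deriv (F * G) : ℝ → ℝ) : RGerm) = (deriv F * G + F * deriv G : ℝ → ℝ)
    refine Germ.coe_eq.2 ?_
    filter_upwards [hf, hg] with t h h' using deriv_mul h h'

theorem germDeriv_neg (f : RGerm) : germDeriv (-f) = -germDeriv f := by
  induction f using Germ.inductionOn with
  | _ F =>
    change ((deriv (-F) : ℝ → ℝ) : RGerm) = (-deriv F : ℝ → ℝ)
    exact congrArg _ (funext fun t => deriv.neg)

theorem germDeriv_const (c : ℝ) : germDeriv ((fun _ => c : ℝ → ℝ) : RGerm) = 0 := by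
  change ((deriv (fun _ => c) : ℝ → ℝ) : RGerm) = (0 : ℝ → ℝ)
  exact congrArg _ (funext fun t => deriv_const t c)

/-- If the generators are differentiable and have their derivatives in the subring `closure s`,
then `closure s` consists of differentiable germs and is closed under differentiation. -/
theorem germDeriv_mem_closure {s : Set RGerm}
    (hs : ∀ f ∈ s, f ∈ differentiableGerms ∧ germDeriv f ∈ Subring.closure s) :
    ∀ f ∈ Subring.closure s, f ∈ differentiableGerms ∧ germDeriv f ∈ Subring.closure s := by
  intro f hf
  induction hf using Subring.closure_induction with
  | mem x hx => exact hs x hx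
  | zero =>
    refine ⟨differentiableSubring.zero_mem, ?_⟩
    rw [show germDeriv 0 = 0 from germDeriv_const 0]
    exact Subring.zero_mem _
  | one =>
    refine ⟨differentiableSubring.one_mem, ?_⟩
    rw [show germDeriv 1 = 0 from germDeriv_const 1]
    exact Subring.zero_mem _
  | add x y hx hy h1 h2 =>
    refine ⟨differentiableSubring.add_mem h1.1 h2.1, ?_⟩
    rw [germDeriv_add h1.1 h2.1]
    exact Subring.add_mem _ h1.2 h2.2
  | neg x hx h1 =>
    refine ⟨differentiableSubring.neg_mem h1.1, ?_⟩
    rw [germDeriv_neg]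
    exact Subring.neg_mem _ h1.2
  | mul x y hx hy h1 h2 =>
    refine ⟨differentiableSubring.mul_mem h1.1 h2.1, ?_⟩
    rw [germDeriv_mul h1.1 h2.1]
    exact Subring.add_mem _ (Subring.mul_mem _ h1.2 hy) (Subring.mul_mem _ hx h2.2)

theorem isHardyField_fractionSubring {R : Subring RGerm}
    (hR : ∀ f ∈ R, f ∈ differentiableGerms ∧ germDeriv f ∈ R)
    (hu : ∀ v ∈ R, v ≠ 0 → IsUnit v) : IsHardyField (fractionSubring R) where
  differentiable := fractionSubring_le_differentiableSubring fun f hf => (hR f hf).1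
  isField := isField_fractionSubring hu
  deriv_mem := by
    intro g hg
    have hgd := fractionSubring_le_differentiableSubring (fun f hf => (hR f hf).1) hg
    obtain ⟨u, hu, v, hv, hv', h⟩ := hg
    refine ⟨germDeriv u * v - u * germDeriv v,
      R.sub_mem (R.mul_mem (hR u hu).2 hv) (R.mul_mem hu (hR v hv).2), v * v, R.mul_mem hv hv,
      hv'.mul hv', ?_⟩
    rw [← h, germDeriv_mul hgd (hR v hv).1]
    ring

end Germs

/-! ### Adjoining a germ that exceeds a field -/

section Order

/-- A continuous unit germ is positive or negative. -/
theorem nonneg_or_neg_nonneg {f : RGerm} (hf : f ∈ continuousGerms) (hu : IsUnit f) :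
    0 ≤ f ∨ 0 ≤ -f := by
  induction f using Germ.inductionOn with
  | _ F =>
    rw [coe_mem_continuousGerms] at hf
    rw [isUnit_coe_iff] at hu
    obtain ⟨a, ha⟩ := eventually_atTop.1 (hf.and hu)
    have hc : ContinuousOn F (Set.Ici a) := fun t ht => (ha t ht).1.continuousWithinAt
    have key : ∀ s ∈ Set.Ici a, ∀ t ∈ Set.Ici a, F s < 0 → ¬ 0 < F t := by
      intro s hs t ht h1 h2
      obtain ⟨x, hx, h0⟩ := isPreconnected_Ici.intermediate_value hs ht hc
        (show (0 : ℝ) ∈ Set.Icc (F s) (F t) from ⟨h1.le, h2.le⟩)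
      exact (ha x hx).2 h0
    rcases lt_or_ge (F a) 0 with h | h
    · right
      refine (eventually_ge_atTop a).mono fun t ht => ?_
      have := not_lt.1 (key a Set.self_mem_Ici t ht h)
      change 0 ≤ - F t
      linarith
    · left
      refine (eventually_ge_atTop a).mono fun t ht => ?_
      change 0 ≤ F t
      by_contra! h'
      exact key t ht a Set.self_mem_Ici h' (lt_of_le_of_ne h (ha a le_rfl).2.symm)

variable {K : Subring RGerm}

/-- The inverse `d` is kept in `K` so that a germ above `K` exceeds it too. -/
theorem exists_inv_nonneg (hK : IsField K) (hc : K ≤ continuousSubring) {k : RGerm} (hk : k ∈ K)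
    (hne : k ≠ 0) : ∃ c ∈ K, ∃ d ∈ K, 0 ≤ c ∧ c * d = 1 ∧ (c = k ∨ c = -k) := by
  obtain ⟨k', hk', e⟩ := exists_inv_of_isField hK hk hne
  rcases nonneg_or_neg_nonneg (hc hk) (IsUnit.of_mul_eq_one _ e) with h | h
  · exact ⟨k, hk, k', hk', h, e, .inl rfl⟩
  · exact ⟨-k, K.neg_mem hk, -k', K.neg_mem hk', h, by rw [neg_mul_neg, e], .inr rfl⟩

/-- Induction step of `exists_le_eval₂`: the part `q * y` of a polynomial outweighs its constant
term `p`. -/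
theorem one_le_mul_add {c d p q y : RGerm} (hc : 0 ≤ c) (hcd : c * d = 1)
    (hq : c ≤ q) (hy : (1 - p) * d ≤ y) (hy0 : 0 ≤ y) : 1 ≤ q * y + p := by
  have h1 : 1 - p ≤ c * y := by
    have := mul_le_mul_of_nonneg_left hy hc
    rwa [show c * ((1 - p) * d) = (1 - p) * (c * d) by ring, hcd, mul_one] at this
  have h2 : c * y ≤ q * y := mul_le_mul_of_nonneg_right hq hy0
  calc (1 : RGerm) = (1 - p) + p := by ring
    _ ≤ q * y + p := by gcongr; exact h1.trans h2

/-- Bounds a fraction `g` with denominator `q ≥ c > 0` by `z / c`. The argument is pointwise, since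
the sign of `g` may vary. -/
theorem le_mul_of_mul_le {c d g q y z : RGerm} (hc : 0 ≤ c) (hcd : c * d = 1) (hq : c ≤ q)
    (hg : g * q ≤ z) (hz : 0 ≤ z) (hy : d ≤ y) : g ≤ z * y := by
  induction g, q using Germ.inductionOn₂ with
  | _ G Q =>
  induction c, d using Germ.inductionOn₂ with
  | _ C D =>
  induction z, y using Germ.inductionOn₂ with
  | _ Z Y =>
    filter_upwards [show ∀ᶠ t in atTop, G t * Q t ≤ Z t from hg,
      show ∀ᶠ t in atTop, C t ≤ Q t from hq, show ∀ᶠ t in atTop, D t ≤ Y t from hy,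
      show ∀ᶠ t in atTop, 0 ≤ Z t from hz, show ∀ᶠ t in atTop, 0 ≤ C t from hc,
      Germ.coe_eq.1 (show ((C * D : ℝ → ℝ) : RGerm) = (1 : ℝ → ℝ) from hcd)]
      with t h1 h2 h3 h4 h5 h6
    have h6 : C t * D t = 1 := h6
    change G t ≤ Z t * Y t
    have hD : 0 < D t := by
      by_contra! h7
      nlinarith
    rcases le_or_gt (G t) 0 with hG | hG
    · exact hG.trans (mul_nonneg h4 (hD.le.trans h3))
    · have h8 : G t * C t ≤ Z t := (mul_le_mul_of_nonneg_left h2 hG.le).trans h1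
      calc G t = G t * C t * D t := by rw [mul_assoc, h6, mul_one]
        _ ≤ Z t * D t := mul_le_mul_of_nonneg_right h8 hD.le
        _ ≤ Z t * Y t := mul_le_mul_of_nonneg_left h3 h4

/-- Nonzero polynomials over `K` in a germ that exceeds all elements of `K` are bounded away from
zero by a positive element of `K`. -/
theorem exists_le_eval₂ (hK : IsField K) (hc : K ≤ continuousSubring) {y : RGerm}
    (hy : ∀ h ∈ K, h ≤ y) (P : Polynomial K) (hP : P ≠ 0) :
    ∃ c ∈ K, ∃ d ∈ K, 0 ≤ c ∧ c * d = 1 ∧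
      (c ≤ P.eval₂ K.subtype y ∨ c ≤ -P.eval₂ K.subtype y) := by
  obtain ⟨n, hn⟩ : ∃ n, P.natDegree ≤ n := ⟨_, le_rfl⟩
  induction n generalizing P with
  | zero =>
    obtain ⟨a, rfl⟩ := Polynomial.natDegree_eq_zero.1 (Nat.le_zero.1 hn)
    have ha : (a : RGerm) ≠ 0 := fun h => hP (by simp [Subtype.ext (a2 := (0 : K)) h])
    obtain ⟨c, hc, d, hd, h0, e, h⟩ := exists_inv_nonneg hK hc a.2 ha
    refine ⟨c, hc, d, hd, h0, e, ?_⟩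
    simpa using h.imp le_of_eq le_of_eq
  | succ n ih =>
    by_cases hQ : P.divX = 0
    · refine ih P hP ?_
      have := P.natDegree_divX_eq_natDegree_tsub_one
      have := P.divX_mul_X_add
      rw [hQ, zero_mul, zero_add] at this
      rw [← this]
      simp
    · obtain ⟨c, hcK, d, hd, h0, e, h⟩ := ih P.divX hQ (by
        have := P.natDegree_divX_eq_natDegree_tsub_one
        omega)
      have hev : P.eval₂ K.subtype y = P.divX.eval₂ K.subtype y * y + (P.coeff 0 : RGerm) := by
        conv_lhs => rw [← P.divX_mul_X_add]
        simp [Polynomial.eval₂_add]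
      have hp := (P.coeff 0).2
      have hy0 : 0 ≤ y := hy 0 K.zero_mem
      -- In positive degree the bound can be `1`, since `y ≥ (1 ∓ p) * d` for the constant term `p`.
      refine ⟨1, K.one_mem, 1, K.one_mem, zero_le_one, one_mul 1, ?_⟩
      rw [hev]
      refine h.imp (fun h => ?_) fun h => ?_
      · exact one_le_mul_add h0 e h (hy _ (K.mul_mem (K.sub_mem K.one_mem hp) hd)) hy0
      · have := one_le_mul_add (p := -(P.coeff 0 : RGerm)) h0 e h
          (hy _ (K.mul_mem (K.sub_mem K.one_mem (K.neg_mem hp)) hd)) hy0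
        rwa [neg_mul, ← neg_add] at this

theorem isUnit_eval₂ (hK : IsField K) (hc : K ≤ continuousSubring) {y : RGerm}
    (hy : ∀ h ∈ K, h ≤ y) {P : Polynomial K} (hP : P ≠ 0) : IsUnit (P.eval₂ K.subtype y) := by
  obtain ⟨c, -, d, -, h0, e, h⟩ := exists_le_eval₂ hK hc hy P hP
  have hu : IsUnit c := IsUnit.of_mul_eq_one _ e
  revert h hu h0
  generalize P.eval₂ K.subtype y = f
  clear e
  induction f, c using Germ.inductionOn₂ with
  | _ F C =>
    intro h0 h hu
    rw [isUnit_coe_iff] at *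
    rcases h with h | h
    · filter_upwards [hu, show ∀ᶠ t in atTop, 0 ≤ C t from h0,
        show ∀ᶠ t in atTop, C t ≤ F t from h] with t h1 h2 h3
      exact ((h2.lt_of_ne h1.symm).trans_le h3).ne'
    · filter_upwards [hu, show ∀ᶠ t in atTop, 0 ≤ C t from h0,
        show ∀ᶠ t in atTop, C t ≤ - F t from h] with t h1 h2 h3
      have := (h2.lt_of_ne h1.symm).trans_le h3
      exact (neg_pos.1 this).ne

/-- One factor `y` absorbs a coefficient, and `2 ≤ y` absorbs the doubling caused by a sum. -/
theorem exists_eval₂_le_pow {y : RGerm} (hy : ∀ h ∈ K, h ≤ y) (P : Polynomial K) :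
    ∃ m : ℕ, P.eval₂ K.subtype y ≤ y ^ m := by
  have h1 : 1 ≤ y := hy 1 K.one_mem
  have h2 : 2 ≤ y := hy 2 (ofNat_mem K 2)
  have h0 : 0 ≤ y := hy 0 K.zero_mem
  induction P using Polynomial.induction_on with
  | C a => exact ⟨1, by simpa using hy a a.2⟩
  | add p q hp hq =>
    obtain ⟨m, hm⟩ := hp
    obtain ⟨n, hn⟩ := hq
    refine ⟨m + n + 1, ?_⟩
    rw [Polynomial.eval₂_add]
    calc _ ≤ y ^ m + y ^ n := add_le_add hm hn
      _ ≤ y ^ (m + n) + y ^ (m + n) := by gcongr <;> first | exact h1 | omega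
      _ = y ^ (m + n) * 2 := by ring
      _ ≤ y ^ (m + n) * y := by gcongr
      _ = _ := by rw [pow_succ]
  | monomial n a _ =>
    refine ⟨n + 2, ?_⟩
    rw [Polynomial.eval₂_mul, Polynomial.eval₂_C, Polynomial.eval₂_X_pow]
    calc (a : RGerm) * y ^ (n + 1) ≤ y * y ^ (n + 1) := by gcongr; exact hy a a.2
      _ = _ := by ring

/-- A field of continuous germs together with a germ `y` exceeding all its elements is contained
in a field of continuous germs that contains `y` and in which the powers of `y` are cofinal. -/
theorem exists_field_extension (hK : IsField K) (hc : K ≤ continuousSubring) {y : RGerm}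
    (hyc : y ∈ continuousGerms) (hy : ∀ h ∈ K, h ≤ y) :
    ∃ L : Subring RGerm, IsField L ∧ L ≤ continuousSubring ∧ K ≤ L ∧ y ∈ L ∧
      ∀ g ∈ L, ∃ m : ℕ, g ≤ y ^ m := by
  set φ := Polynomial.eval₂RingHom K.subtype y with hφ
  have hR : φ.range ≤ continuousSubring := by
    rintro _ ⟨P, rfl⟩
    change P.eval₂ K.subtype y ∈ _
    rw [Polynomial.eval₂_eq_sum_range]
    exact Subring.sum_mem _ fun i _ => Subring.mul_mem _ (hc (P.coeff i).2)
      (Subring.pow_mem continuousSubring hyc i)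
  have hmem : ∀ k (hk : k ∈ K), k ∈ φ.range := fun k hk =>
    ⟨Polynomial.C ⟨k, hk⟩, by simp [hφ]⟩
  have h1 : 1 ≤ y := hy 1 K.one_mem
  have h0 : 0 ≤ y := hy 0 K.zero_mem
  refine ⟨fractionSubring φ.range, isField_fractionSubring ?_,
    fractionSubring_le_continuousSubring hR, fun k hk => le_fractionSubring _ (hmem k hk),
    le_fractionSubring _ ⟨Polynomial.X, by simp [hφ]⟩, ?_⟩
  · rintro _ ⟨P, rfl⟩ hne
    exact isUnit_eval₂ hK hc hy fun h => hne (by rw [h, map_zero])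
  · rintro g ⟨_, ⟨P, rfl⟩, _, ⟨Q, rfl⟩, hu, h⟩
    have hQ : Q ≠ 0 := by
      rintro rfl
      rw [map_zero] at hu
      exact not_isUnit_zero hu
    have key : ∀ {P Q : Polynomial K} {c : RGerm}, c ∈ K → (∃ d ∈ K, 0 ≤ c ∧ c * d = 1) →
        c ≤ φ Q → g * φ Q = φ P → ∃ m : ℕ, g ≤ y ^ m := by
      rintro P Q c - ⟨d, hd, hc0, e⟩ hcQ h
      obtain ⟨m, hm⟩ := exists_eval₂_le_pow hy P
      refine ⟨m + 1, ?_⟩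
      rw [pow_succ]
      exact le_mul_of_mul_le hc0 e hcQ (h.trans_le hm) (pow_nonneg h0 m) (hy d hd)
    obtain ⟨c, hcK, d, hd, hc0, e, hcQ | hcQ⟩ := exists_le_eval₂ hK hc hy Q hQ
    · exact key hcK ⟨d, hd, hc0, e⟩ hcQ h
    -- A negative denominator is made positive by changing both signs.
    · refine key (P := -P) (Q := -Q) hcK ⟨d, hd, hc0, e⟩ ?_ ?_
      · rw [map_neg]; exact hcQ
      · rw [map_neg, map_neg, ← h, mul_neg]

end Order

/-! ### The Hardy field generated by a tower -/

/-- Given a sequence of germs exceeding a Hardy field `H`, each exceeding all powers of the next,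
any finitely many of them lie in a field of continuous germs extending `H`. -/
theorem exists_field_of_tower {H : Subring RGerm} (hH : IsHardyField H) {y : ℕ → RGerm}
    (hc : ∀ n, y n ∈ continuousGerms) (hgt : ∀ n, ∀ h ∈ H, h ≤ y n)
    (hpow : ∀ n m, y (n + 1) ^ m ≤ y n) (j i : ℕ) :
    ∃ L : Subring RGerm, IsField L ∧ L ≤ continuousSubring ∧ H ≤ L ∧
      (∀ n, i ≤ n → n ≤ i + j → y n ∈ L) ∧ ∀ g ∈ L, ∃ m : ℕ, g ≤ y i ^ m := by
  induction j generalizing i with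
  | zero =>
    obtain ⟨L, h1, h2, h3, h4, h5⟩ := exists_field_extension hH.isField
      (fun f hf => differentiableGerms_subset_continuousGerms (hH.differentiable f hf)) (hc i)
      (hgt i)
    refine ⟨L, h1, h2, h3, fun n hn hn' => ?_, h5⟩
    rwa [show n = i by omega]
  | succ j ih =>
    -- The higher indices are adjoined before `y i`: powers of `y (i + 1)` are cofinal in `L`, so `y
    -- i` exceeds `L`.
    obtain ⟨L, h1, h2, h3, h4, h5⟩ := ih (i + 1)
    obtain ⟨L', h1', h2', h3', h4', h5'⟩ := exists_field_extension h1 h2 (hc i) fun g hg => by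
      obtain ⟨m, hm⟩ := h5 g hg
      exact hm.trans (hpow i m)
    refine ⟨L', h1', h2', h3.trans h3', fun n hn hn' => ?_, h5'⟩
    rcases hn.eq_or_lt with rfl | hn
    · exact h4'
    · exact h3' (h4 n hn (by omega))

/-- A criterion for a germ to generate a Hardy field, in terms of its iterated logarithmic
derivatives. -/
theorem exists_generatesOver {H : Subring RGerm} (hH : IsHardyField H) {y : ℕ → RGerm}
    (hd : ∀ n, y n ∈ differentiableGerms) (hder : ∀ n, germDeriv (y n) = y n * y (n + 1))
    (hgt : ∀ n, ∀ h ∈ H, h ≤ y n) (hpow : ∀ n m, y (n + 1) ^ m ≤ y n) :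
    ∃ K : Subring RGerm, GeneratesOver H (y 0) K := by
  have hc n := differentiableGerms_subset_continuousGerms (hd n)
  set s : Set RGerm := H ∪ Set.range y with hs
  -- An element of the closure involves only finitely many `y n`.
  have hsub : ∀ f ∈ Subring.closure s, ∃ N : ℕ, ∀ L : Subring RGerm, H ≤ L →
      (∀ n ≤ N, y n ∈ L) → f ∈ L := by
    intro f hf
    induction hf using Subring.closure_induction with
    | mem x hx =>
      rcases hx with hx | ⟨n, rfl⟩
      · exact ⟨0, fun L h _ => h hx⟩
      · exact ⟨n, fun L _ h => h n le_rfl⟩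
    | zero => exact ⟨0, fun L _ _ => L.zero_mem⟩
    | one => exact ⟨0, fun L _ _ => L.one_mem⟩
    | neg x _ h =>
      obtain ⟨N, h⟩ := h
      exact ⟨N, fun L h1 h2 => L.neg_mem (h L h1 h2)⟩
    | add x z _ _ h h' =>
      obtain ⟨N, h⟩ := h
      obtain ⟨N', h'⟩ := h'
      exact ⟨max N N', fun L h1 h2 => L.add_mem
        (h L h1 fun n hn => h2 n (hn.trans (le_max_left _ _)))
        (h' L h1 fun n hn => h2 n (hn.trans (le_max_right _ _)))⟩
    | mul x z _ _ h h' =>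
      obtain ⟨N, h⟩ := h
      obtain ⟨N', h'⟩ := h'
      exact ⟨max N N', fun L h1 h2 => L.mul_mem
        (h L h1 fun n hn => h2 n (hn.trans (le_max_left _ _)))
        (h' L h1 fun n hn => h2 n (hn.trans (le_max_right _ _)))⟩
  have hunit : ∀ v ∈ Subring.closure s, v ≠ 0 → IsUnit v := by
    intro v hv hne
    obtain ⟨N, hN⟩ := hsub v hv
    obtain ⟨L, h1, -, h3, h4, -⟩ := exists_field_of_tower hH hc hgt hpow N 0
    obtain ⟨v', -, e⟩ := exists_inv_of_isField h1
      (hN L h3 fun n hn => h4 n n.zero_le (by omega)) hne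
    exact IsUnit.of_mul_eq_one _ e
  have hys n : y n ∈ Subring.closure s := Subring.subset_closure (.inr ⟨n, rfl⟩)
  have hHs : H ≤ Subring.closure s := fun f hf => Subring.subset_closure (.inl hf)
  refine ⟨fractionSubring (Subring.closure s),
    ⟨isHardyField_fractionSubring (germDeriv_mem_closure ?_) hunit,
      hHs.trans (le_fractionSubring _), le_fractionSubring _ (hys 0)⟩, ?_⟩
  · rintro f (hf | ⟨n, rfl⟩)
    · exact ⟨hH.differentiable f hf, hHs (hH.deriv_mem f hf)⟩
    · exact ⟨hd n, by rw [hder]; exact Subring.mul_mem _ (hys n) (hys _)⟩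
  · rintro L ⟨hL, hHL, hyL⟩
    have hyne : ∀ n, y n ≠ 0 := fun n h => by
      have h1 := hgt n 1 H.one_mem
      rw [h] at h1
      exact absurd h1 (not_le_of_gt zero_lt_one)
    -- Each `y (n + 1)` is the logarithmic derivative of `y n`.
    have hyL n : y n ∈ L := by
      induction n with
      | zero => exact hyL
      | succ n ih =>
        obtain ⟨z, hz, e⟩ := exists_inv_of_isField hL.isField ih (hyne n)
        have : y (n + 1) = germDeriv (y n) * z := by
          rw [hder]
          linear_combination -y (n + 1) * e
        rw [this]
        exact L.mul_mem (hL.deriv_mem _ ih) hz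
    have hle : Subring.closure s ≤ L := by
      rw [Subring.closure_le]
      rintro f (hf | ⟨n, rfl⟩)
      · exact hHL hf
      · exact hyL n
    rintro g ⟨u, hu, v, hv, hv', h⟩
    obtain ⟨w, hw, e⟩ := exists_inv_of_isField hL.isField (hle hv) hv'.ne_zero
    have : g = u * w := by
      rw [← h]
      linear_combination -g * e
    rw [this]
    exact L.mul_mem (hle hu) hw



/-! ### Smooth transitions -/

theorem contDiff_integral {p : ℝ → ℝ} (hp : ContDiff ℝ (⊤ : ℕ∞) p) (a : ℝ) :
    ContDiff ℝ (⊤ : ℕ∞) fun t => ∫ u in a..t, p u := by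
  have h t : HasDerivAt (fun t => ∫ u in a..t, p u) (p t) t :=
    (hp.continuous.integral_hasStrictDerivAt a t).hasDerivAt
  rw [contDiff_infty_iff_deriv]
  refine ⟨fun t => (h t).differentiableAt, ?_⟩
  rwa [show deriv (fun t => ∫ u in a..t, p u) = p from funext fun t => (h t).deriv]

/-- Smooth transitions from `0` to an arbitrarily large constant `D` that are bounded by the square
of their integral, up to a shift independent of `D`. -/
theorem exists_transition : ∃ C : ℝ, 0 ≤ C ∧ ∀ D : ℝ, 0 ≤ D → ∃ g : ℝ → ℝ,
    ContDiff ℝ (⊤ : ℕ∞) g ∧ (∀ t, 0 ≤ g t) ∧ (∀ t ≤ 0, g t = 0) ∧ (∀ t, 1 ≤ t → g t = D) ∧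
    ∀ t, 0 ≤ t → t ≤ 1 → g t ≤ ((∫ u in (0 : ℝ)..t, g u) + C) ^ 2 := by
  have hS : ContDiff ℝ (⊤ : ℕ∞) Real.smoothTransition := Real.smoothTransition.contDiff
  obtain ⟨B, hB⟩ := (isCompact_Icc (a := (0 : ℝ)) (b := 1)).exists_bound_of_continuousOn
    (hS.continuous_deriv (by simp)).continuousOn
  set Λ := max B 1 with hΛ
  have hΛ1 : 1 ≤ Λ := le_max_right _ _
  have hΛ0 : 0 < Λ := by linarith
  refine ⟨Λ ^ 2 + Λ, by positivity, fun D hD => ?_⟩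
  -- The model is `v' = v ^ 2`, whose solutions climb from `Λ` to any height in bounded time. Here
  -- `v = w⁻¹` rises from `Λ` to `r`, so `v ^ 2 - Λ ^ 2` goes from `0` to `D`.
  set r := Real.sqrt (D + Λ ^ 2) with hr
  have hr2 : r ^ 2 = D + Λ ^ 2 := Real.sq_sqrt (by positivity)
  have hrΛ : Λ ≤ r := Real.le_sqrt_of_sq_le (by linarith)
  have hr0 : 0 < r := by linarith
  set δ := Λ⁻¹ - r⁻¹ with hδ
  have hδ0 : 0 ≤ δ := sub_nonneg.2 (inv_anti₀ hΛ0 hrΛ)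
  have hδΛ : δ * Λ ≤ 1 := by
    have : Λ⁻¹ * Λ = 1 := inv_mul_cancel₀ hΛ0.ne'
    have : 0 ≤ r⁻¹ * Λ := by positivity
    rw [hδ, sub_mul]; linarith
  set w : ℝ → ℝ := fun t => Λ⁻¹ - δ * Real.smoothTransition t with hw
  have hwr t : r⁻¹ ≤ w t := by
    have := mul_le_mul_of_nonneg_left (Real.smoothTransition.le_one t) hδ0
    simp only [hw]; linarith
  have hw0 t : 0 < w t := (inv_pos.2 hr0).trans_le (hwr t)
  have hwΛ t : w t ≤ Λ⁻¹ := by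
    have := mul_nonneg hδ0 (Real.smoothTransition.nonneg t)
    simp only [hw]; linarith
  have hΛw t : Λ ≤ (w t)⁻¹ := by
    rw [le_inv_comm₀ hΛ0 (hw0 t)]; exact hwΛ t
  have hwc : ContDiff ℝ (⊤ : ℕ∞) w := contDiff_const.sub (contDiff_const.mul hS)
  have hgc : ContDiff ℝ (⊤ : ℕ∞) fun t => (w t)⁻¹ ^ 2 - Λ ^ 2 :=
    ((hwc.inv fun t => (hw0 t).ne').pow 2).sub contDiff_const
  refine ⟨fun t => (w t)⁻¹ ^ 2 - Λ ^ 2, hgc, fun t => ?_, fun t ht => ?_, fun t ht => ?_,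
    fun t ht0 ht1 => ?_⟩
  · exact sub_nonneg.2 (pow_le_pow_left₀ hΛ0.le (hΛw t) 2)
  · simp [hw, Real.smoothTransition.zero_of_nonpos ht]
  · simp only [hw, Real.smoothTransition.one_of_one_le ht, hδ, mul_one, sub_sub_cancel, inv_inv]
    linarith
  · set G : ℝ → ℝ := fun t => ∫ u in (0 : ℝ)..t, ((w u)⁻¹ ^ 2 - Λ ^ 2) with hG
    have hGd x : HasDerivAt G ((w x)⁻¹ ^ 2 - Λ ^ 2) x :=
      (hgc.continuous.integral_hasStrictDerivAt 0 x).hasDerivAt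
    have hwd x : HasDerivAt (fun x => (w x)⁻¹)
        (-(-(δ * deriv Real.smoothTransition x)) / (w x) ^ 2) x :=
      HasDerivAt.fun_inv (((hS.differentiable (by simp) x).hasDerivAt.const_mul δ).const_sub _)
        (hw0 x).ne'
    -- On `[0, 1]` the derivative of `w⁻¹` is at most `w⁻¹ ^ 2 = G' + Λ ^ 2`. Integration gives `w⁻¹
    -- ≤ G + Λ ^ 2 + Λ`, the source of the shift.
    have hmono : MonotoneOn (fun x => G x + Λ ^ 2 * x - (w x)⁻¹) (Set.Icc 0 1) := by
      have hd x := ((hGd x).add ((hasDerivAt_id x).const_mul (Λ ^ 2))).sub (hwd x)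
      refine monotoneOn_of_hasDerivWithinAt_nonneg (convex_Icc 0 1)
        (fun x _ => (hd x).continuousAt.continuousWithinAt)
        (fun x _ => (hd x).hasDerivWithinAt) fun x hx => ?_
      have h1 : deriv Real.smoothTransition x ≤ Λ :=
        ((le_abs_self _).trans (hB x (interior_subset hx))).trans (le_max_left _ _)
      have h2 : δ * deriv Real.smoothTransition x ≤ 1 :=
        (mul_le_mul_of_nonneg_left h1 hδ0).trans hδΛ
      have h3 : δ * deriv Real.smoothTransition x / w x ^ 2 ≤ (w x)⁻¹ ^ 2 := by
        rw [inv_pow, ← one_div]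
        exact div_le_div_of_nonneg_right h2 (by positivity)
      rw [neg_neg]
      linarith
    have h := hmono (Set.left_mem_Icc.2 zero_le_one) (⟨ht0, ht1⟩ : t ∈ Set.Icc (0 : ℝ) 1) ht0
    have hw00 : (w 0)⁻¹ = Λ := by simp [hw]
    have hG0 : G 0 = 0 := by simp [hG]
    simp only [hw00, hG0] at h
    change (w t)⁻¹ ^ 2 - Λ ^ 2 ≤ (G t + (Λ ^ 2 + Λ)) ^ 2
    have h4 : Λ ^ 2 * t ≤ Λ ^ 2 := mul_le_of_le_one_right (by positivity) ht1
    have h5 : (w t)⁻¹ ≤ G t + (Λ ^ 2 + Λ) := by linarith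
    have h6 := pow_le_pow_left₀ (hΛ0.le.trans (hΛw t)) h5 2
    linarith [sq_nonneg Λ]

/-! ### The infinite system of differential equations -/

section Tower

variable (c : ℕ → ℝ) (g : ℕ → ℝ → ℝ)

/-- Approximants to a solution of the infinite system
`f k' = f k * (g k + f (k + 1) - c (k + 1))`, `f k k = c k`. -/
noncomputable def towerApprox : ℕ → ℕ → ℝ → ℝ
  | 0, k => fun _ => c k
  | n + 1, k => fun t =>
      c k * Real.exp (∫ u in (k : ℝ)..t, (g k u + towerApprox n (k + 1) u - c (k + 1)))

variable {c g}

theorem contDiff_towerApprox (hg : ∀ k, ContDiff ℝ (⊤ : ℕ∞) (g k)) (n k : ℕ) :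
    ContDiff ℝ (⊤ : ℕ∞) (towerApprox c g n k) := by
  induction n generalizing k with
  | zero => exact contDiff_const
  | succ n ih =>
    exact contDiff_const.mul
      (contDiff_integral (((hg k).add (ih (k + 1))).sub contDiff_const) _).exp

/-- Before time `k` level `k + 1` is still constant too, so the exponent vanishes. -/
theorem towerApprox_of_le (hg0 : ∀ (k : ℕ) (t : ℝ), t ≤ k → g k t = 0) (n k : ℕ)
    {t : ℝ} (ht : t ≤ k) :
    towerApprox c g n k t = c k := by
  induction n generalizing k t with
  | zero => rfl
  | succ n ih =>
    have : ∫ u in (k : ℝ)..t, (g k u + towerApprox c g n (k + 1) u - c (k + 1)) =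
        ∫ u in (k : ℝ)..t, (0 : ℝ) := by
      refine intervalIntegral.integral_congr fun u hu => ?_
      rw [Set.uIcc_of_ge ht] at hu
      have := ih (k + 1) (t := u) (by push_cast; linarith [hu.2])
      simp [this, hg0 k u hu.2]
    simp [towerApprox, this]

/-- Each iteration passes to the next level, which starts one unit of time later. Hence the
approximants stabilise on bounded intervals. -/
theorem towerApprox_succ (hg0 : ∀ (k : ℕ) (t : ℝ), t ≤ k → g k t = 0) (n k : ℕ) {t : ℝ}
    (ht : t ≤ k + n) : towerApprox c g (n + 1) k t = towerApprox c g n k t := by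
  induction n generalizing k t with
  | zero =>
    rw [towerApprox_of_le hg0 _ _ (by simpa using ht)]; rfl
  | succ n ih =>
    push_cast at ht
    simp only [towerApprox]
    congr 2
    refine intervalIntegral.integral_congr fun u hu => ?_
    have hu2 : u ≤ max (k : ℝ) t := hu.2
    have : u ≤ ((k + 1 : ℕ) : ℝ) + n := by
      refine hu2.trans (max_le ?_ ?_) <;> push_cast <;> linarith [n.cast_nonneg (α := ℝ)]
    have := ih (k + 1) this
    simp only [towerApprox] at this
    simp only [this]

theorem towerApprox_eq_of_le (hg0 : ∀ (k : ℕ) (t : ℝ), t ≤ k → g k t = 0) {n m : ℕ} (hnm : n ≤ m)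
    (k : ℕ) {t : ℝ} (ht : t ≤ n) : towerApprox c g m k t = towerApprox c g n k t := by
  induction m, hnm using Nat.le_induction with
  | base => rfl
  | succ m hm ih =>
    rw [towerApprox_succ hg0, ih]
    have : (n : ℝ) ≤ m := by exact_mod_cast hm
    linarith [k.cast_nonneg (α := ℝ)]

theorem le_towerApprox (hc : ∀ k, 0 ≤ c k) (hg0 : ∀ (k : ℕ) (t : ℝ), t ≤ k → g k t = 0)
    (hgn : ∀ k t, 0 ≤ g k t) (n k : ℕ) (t : ℝ) : c k ≤ towerApprox c g n k t := by
  induction n generalizing k t with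
  | zero => exact le_rfl
  | succ n ih =>
    rcases le_total t k with h | h
    · exact (towerApprox_of_le hg0 _ _ h).ge
    · refine le_mul_of_one_le_right (hc k) (Real.one_le_exp ?_)
      refine intervalIntegral.integral_nonneg h fun u _ => ?_
      linarith [hgn k u, ih (k + 1) u]

theorem hasDerivAt_towerApprox (hg : ∀ k, ContDiff ℝ (⊤ : ℕ∞) (g k)) (n k : ℕ) (t : ℝ) :
    HasDerivAt (towerApprox c g (n + 1) k) (towerApprox c g (n + 1) k t *
      (g k t + towerApprox c g n (k + 1) t - c (k + 1))) t := by
  have := ((((hg k).add (contDiff_towerApprox (c := c) hg n (k + 1))).sub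
    (contDiff_const (c := c (k + 1)))).continuous.integral_hasStrictDerivAt k t).hasDerivAt
  have h2 := this.exp.const_mul (c k)
  rw [← mul_assoc] at h2
  exact h2

theorem exists_tower (hc : ∀ k, 0 ≤ c k) (hg : ∀ k, ContDiff ℝ (⊤ : ℕ∞) (g k))
    (hg0 : ∀ (k : ℕ) (t : ℝ), t ≤ k → g k t = 0) (hgn : ∀ k t, 0 ≤ g k t) :
    ∃ f : ℕ → ℝ → ℝ, (∀ k, ContDiff ℝ (⊤ : ℕ∞) (f k)) ∧ (∀ (k : ℕ) (t : ℝ), t ≤ k → f k t = c k) ∧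
      (∀ k t, c k ≤ f k t) ∧
      ∀ k t, HasDerivAt (f k) (f k t * (g k t + f (k + 1) t - c (k + 1))) t := by
  -- Stage `⌈t⌉₊` is already stable at time `t`, for every level.
  set f : ℕ → ℝ → ℝ := fun k t => towerApprox c g ⌈t⌉₊ k t with hf
  have hfn (k n : ℕ) (t : ℝ) (ht : t ≤ n) : f k t = towerApprox c g n k t :=
    (towerApprox_eq_of_le hg0 (Nat.ceil_le.2 ht) k (Nat.le_ceil t)).symm
  have hev (k n : ℕ) (t : ℝ) (ht : t < n) : f k =ᶠ[𝓝 t] towerApprox c g n k := by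
    filter_upwards [Iio_mem_nhds ht] with s hs using hfn k n s (le_of_lt hs)
  refine ⟨f, fun k => ?_, fun k t ht => towerApprox_of_le hg0 _ _ ht,
    fun k t => le_towerApprox hc hg0 hgn _ _ _, fun k t => ?_⟩
  · rw [contDiff_iff_contDiffAt]
    intro t
    obtain ⟨n, hn⟩ := exists_nat_gt t
    exact (contDiff_towerApprox hg n k).contDiffAt.congr_of_eventuallyEq (hev k n t hn)
  · obtain ⟨n, hn⟩ := exists_nat_gt t
    have hn' : t < (n + 1 : ℕ) := by push_cast; linarith
    rw [(hev k (n + 1) t hn').hasDerivAt_iff, hfn k (n + 1) t hn'.le, hfn (k + 1) n t hn.le]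
    exact hasDerivAt_towerApprox hg n k t

end Tower

theorem exists_log_sq_le_sqrt : ∃ A : ℝ, 1 ≤ A ∧ ∀ x, A ≤ x → Real.log x ^ 2 ≤ Real.sqrt x := by
  have h := (Real.isLittleO_pow_log_id_atTop (n := 4)).bound one_pos
  obtain ⟨A, hA⟩ := eventually_atTop.1 h
  refine ⟨max A 1, le_max_right _ _, fun x hx => ?_⟩
  have h1 := hA x ((le_max_left _ _).trans hx)
  have hx0 : 0 ≤ x := zero_le_one.trans ((le_max_right _ _).trans hx)
  refine Real.le_sqrt_of_sq_le ?_
  rw [one_mul, id, Real.norm_of_nonneg (by positivity), Real.norm_of_nonneg hx0] at h1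
  calc _ = Real.log x ^ 4 := by ring
    _ ≤ x := h1

/-! ### Growth of the levels -/

section Estimates

variable {c : ℕ → ℝ} {g f : ℕ → ℝ → ℝ} {C A : ℝ}

/-- The logarithmic derivative of `f k` is at most the square of its logarithm, on `[k, ∞)`. -/
theorem tower_logDeriv_le (hC : 0 ≤ C) (hA1 : 1 ≤ A)
    (hA : ∀ x, A ≤ x → Real.log x ^ 2 ≤ Real.sqrt x) (hcA : ∀ k, A ≤ c k)
    (hcC : ∀ k, C ≤ Real.log (c k))
    (hgc : ∀ k, Continuous (g k))
    (hg1 : ∀ (k : ℕ) (t : ℝ), k + 1 ≤ t → g k t = c (k + 1))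
    (hgsq : ∀ (k : ℕ) (t : ℝ), k ≤ t → t ≤ k + 1 → g k t ≤ ((∫ u in (k : ℝ)..t, g k u) + C) ^ 2)
    (hf0 : ∀ (k : ℕ) (t : ℝ), t ≤ k → f k t = c k) (hfc : ∀ k t, c k ≤ f k t)
    (hfd : ∀ k t, HasDerivAt (f k) (f k t * (g k t + f (k + 1) t - c (k + 1))) t)
    (k : ℕ) (t : ℝ) (ht : (k : ℝ) ≤ t) :
    g k t + f (k + 1) t - c (k + 1) ≤ Real.log (f k t) ^ 2 := by
  have hfA k t : A ≤ f k t := (hcA k).trans (hfc k t)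
  have hfp k t : 0 < f k t := by linarith [hfA k t]
  have hcp k : 0 < c k := by linarith [hcA k]
  have hlog k t : HasDerivAt (fun t => Real.log (f k t)) (g k t + f (k + 1) t - c (k + 1)) t := by
    have := (hfd k t).log (hfp k t).ne'
    rwa [mul_div_cancel_left₀ _ (hfp k t).ne'] at this
  have hlogc k t : Real.log (c k) ≤ Real.log (f k t) := Real.log_le_log (hcp k) (hfc k t)
  have hlin (k : ℕ) : ∀ t : ℝ, (k : ℝ) ≤ t → t ≤ k + 1 →
      g k t + f (k + 1) t - c (k + 1) ≤ (Real.log (f k t) - Real.log (c k) + C) ^ 2 := by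
    intro t h1 h2
    have hp : ∀ u ≤ (k : ℝ) + 1, g k u + f (k + 1) u - c (k + 1) = g k u := fun u hu => by
      rw [hf0 (k + 1) u (by push_cast; exact hu)]; ring
    have hint : ∫ u in (k : ℝ)..t, g k u = Real.log (f k t) - Real.log (f k k) := by
      refine intervalIntegral.integral_eq_sub_of_hasDerivAt
        (f := fun s => Real.log (f k s)) (fun u hu => ?_)
        ((hgc k).intervalIntegrable _ _)
      rw [Set.uIcc_of_le h1] at hu
      have := hlog k u
      rwa [hp u (hu.2.trans h2)] at this
    rw [hp t h2, ← hf0 k k le_rfl, ← hint]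
    exact hgsq k t h1 h2
  have hsq k t : (Real.log (f k t) - Real.log (c k) + C) ^ 2 ≤ Real.log (f k t) ^ 2 :=
    pow_le_pow_left₀ (by linarith [hlogc k t]) (by linarith [hcC k]) 2
  -- Induction on elapsed time, for all levels at once: level `k` on `[k, k + n + 1]` relies on
  -- level `k + 1` on `[k + 1, k + 1 + n]`.
  suffices H : ∀ n : ℕ, ∀ (k : ℕ) (t : ℝ), k ≤ t → t ≤ k + n →
      g k t + f (k + 1) t - c (k + 1) ≤ (Real.log (f k t) - Real.log (c k) + C) ^ 2 by
    obtain ⟨n, hn⟩ := exists_nat_ge (t - k)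
    exact (H n k t ht (by linarith)).trans (hsq k t)
  intro n
  induction n with
  | zero => exact fun k t h1 h2 => hlin k t h1 (by norm_num at h2; linarith)
  | succ n ih =>
    intro k t h1 h2
    rcases le_total t (k + 1) with h | h
    · exact hlin k t h1 h
    have hd u := ((hlog k u).sub_const (Real.log (c k))).sub
      ((hfd (k + 1) u).sqrt (hfp (k + 1) u).ne')
    -- For `t ≥ k + 1` the claim reads `√(f (k + 1)) ≤ log (f k) - log (c k) + C`. It holds at `k +
    -- 1` and persists: the left side has derivative at most `f (k + 1) / 2` by induction and `hA`,
    -- the right side `f (k + 1)`.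
    have hmono : MonotoneOn
        (fun u => Real.log (f k u) - Real.log (c k) - Real.sqrt (f (k + 1) u))
        (Set.Icc (k + 1 : ℝ) t) := by
      refine monotoneOn_of_hasDerivWithinAt_nonneg (convex_Icc _ _)
        (fun x _ => (hd x).continuousAt.continuousWithinAt)
        (fun x _ => (hd x).hasDerivWithinAt) fun x hx => ?_
      have hx := interior_subset hx
      rw [hg1 k x hx.1]
      set s := Real.sqrt (f (k + 1) x) with hs
      have hs0 : 0 < s := Real.sqrt_pos.2 (hfp _ _)
      have hss : f (k + 1) x = s * s := (Real.mul_self_sqrt (hfp _ _).le).symm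
      have h3 := ((ih (k + 1) x (by push_cast; exact hx.1)
        (by push_cast at h2 ⊢; linarith [hx.2])).trans (hsq (k + 1) x)).trans
          (hA _ (hfA (k + 1) x))
      set p := g (k + 1) x + f (k + 1 + 1) x - c (k + 1 + 1) with hp
      change p ≤ s at h3
      rw [hss, sub_nonneg, div_le_iff₀ (by positivity)]
      nlinarith [mul_le_mul_of_nonneg_left h3 (mul_pos hs0 hs0).le, mul_pos hs0 hs0,
        mul_pos (mul_pos hs0 hs0) hs0]
    have h3 := hmono (Set.left_mem_Icc.2 h) (Set.right_mem_Icc.2 h) h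
    simp only at h3
    have h4 := hlin k (k + 1) (by linarith) le_rfl
    have h5 : 0 ≤ Real.log (f k (k + 1)) - Real.log (c k) + C := by linarith [hlogc k (k + 1)]
    rw [hg1 k _ le_rfl, add_sub_cancel_left] at h4
    have h6 := Real.sqrt_le_sqrt h4
    rw [Real.sqrt_sq h5] at h6
    rw [hg1 k t h, add_sub_cancel_left, ← Real.sq_sqrt (hfp (k + 1) t).le]
    exact pow_le_pow_left₀ (Real.sqrt_nonneg _) (by linarith) 2

end Estimates

/-! ### The tower above a continuous function -/

/-- Above every continuous function there is a sequence of smooth functions, each the logarithmic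
derivative of the preceding one, and each eventually dominating all powers of the next. -/
theorem exists_logDeriv_tower {ψ : ℝ → ℝ} (hψ : Continuous ψ) :
    ∃ f : ℕ → ℝ → ℝ, (∀ k, ContDiff ℝ (⊤ : ℕ∞) (f k)) ∧
      (∀ k, ∀ᶠ t in atTop, HasDerivAt (f k) (f k t * f (k + 1) t) t) ∧
      (∀ k, ∀ᶠ t in atTop, ψ t < f k t) ∧
      ∀ k m, ∀ᶠ t in atTop, f (k + 1) t ^ m ≤ f k t := by
  obtain ⟨C, hC, hG⟩ := exists_transition
  obtain ⟨A, hA1, hA⟩ := exists_log_sq_le_sqrt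
  have hB (k : ℕ) : ∃ B : ℝ, ∀ t ∈ Set.Icc (k : ℝ) (k + 1), ‖ψ t‖ ≤ B :=
    isCompact_Icc.exists_bound_of_continuousOn hψ.continuousOn
  choose B hB using hB
  -- `A` and `exp C` serve the growth estimate, `B k + 1` exceeds `ψ` on `[k, k + 1]`, and `k` makes
  -- every level tend to infinity.
  set c : ℕ → ℝ := fun k => max (max A (Real.exp C)) (max (B k + 1) k) with hc
  have hcA k : A ≤ c k := (le_max_left _ _).trans (le_max_left _ _)
  have hcp k : 0 < c k := by linarith [hcA k]
  have hcC k : C ≤ Real.log (c k) :=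
    (Real.le_log_iff_exp_le (hcp k)).2 ((le_max_right _ _).trans (le_max_left _ _))
  have hcB k : B k + 1 ≤ c k := (le_max_left _ _).trans (le_max_right _ _)
  have hck (k : ℕ) : (k : ℝ) ≤ c k := (le_max_right _ _).trans (le_max_right _ _)
  choose G hGc hGn hG0 hG1 hGsq using fun k => hG (c (k + 1)) (hcp (k + 1)).le
  set g : ℕ → ℝ → ℝ := fun k t => G k (t - k) with hg
  have hgc k : ContDiff ℝ (⊤ : ℕ∞) (g k) := (hGc k).comp (contDiff_id.sub contDiff_const)
  have hgn k t : 0 ≤ g k t := hGn k _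
  obtain ⟨f, hfs, hf0, hfc, hfd⟩ := exists_tower (c := c) (g := g) (fun k => (hcp k).le) hgc
    (fun k t ht => hG0 k _ (by linarith)) hgn
  have hg1 (k : ℕ) (t : ℝ) (ht : k + 1 ≤ t) : g k t = c (k + 1) := hG1 k _ (by linarith)
  have hle (k : ℕ) (t : ℝ) (ht : k + 1 ≤ t) : f (k + 1) t ≤ Real.log (f k t) ^ 2 := by
    have := tower_logDeriv_le hC hA1 hA hcA hcC (fun k => (hgc k).continuous) hg1
      (fun k t h1 h2 => ?_) hf0 hfc hfd k t (by linarith)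
    · rwa [hg1 k t ht, add_sub_cancel_left] at this
    · have := hGsq k (t - k) (by linarith) (by linarith)
      simp only [hg]
      rw [intervalIntegral.integral_comp_sub_right (fun x => G k x), sub_self]
      exact this
  have hanti (k : ℕ) (t : ℝ) (ht : k + 1 ≤ t) : f (k + 1) t ≤ f k t := by
    have hfA : A ≤ f k t := (hcA k).trans (hfc k t)
    refine ((hle k t ht).trans (hA _ hfA)).trans ?_
    exact Real.sqrt_le_iff.2 ⟨by linarith, by nlinarith⟩
  have hanti' (k j : ℕ) (hkj : k ≤ j) : ∀ t, (j : ℝ) ≤ t → f j t ≤ f k t := by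
    induction j, hkj using Nat.le_induction with
    | base => exact fun t _ => le_rfl
    | succ j hj ih =>
      intro t ht
      push_cast at ht
      exact (hanti j t ht).trans (ih t (by linarith))
  -- At time `t` the levels up to `⌊t⌋₊` decrease with the index, so level `k` inherits the lower
  -- bound of level `⌊t⌋₊`.
  have hlow (k : ℕ) (t : ℝ) (ht : k ≤ t) : c ⌊t⌋₊ ≤ f k t :=
    (hfc _ t).trans (hanti' k _ (Nat.le_floor ht) t (Nat.floor_le (k.cast_nonneg.trans ht)))
  have htop (k : ℕ) : Tendsto (f k) atTop atTop := by
    refine tendsto_atTop_mono' atTop ?_ (tendsto_natCast_atTop_atTop.comp tendsto_nat_floor_atTop)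
    filter_upwards [eventually_ge_atTop (k : ℝ)] with t ht using (hck _).trans (hlow k t ht)
  refine ⟨f, hfs, fun k => ?_, fun k => ?_, fun k m => ?_⟩
  · filter_upwards [eventually_ge_atTop (k + 1 : ℝ)] with t ht
    have := hfd k t
    rwa [hg1 k t ht, add_sub_cancel_left] at this
  · filter_upwards [eventually_ge_atTop (k : ℝ)] with t ht
    have ht0 : 0 ≤ t := k.cast_nonneg.trans ht
    have h1 := (le_abs_self _).trans
      (hB ⌊t⌋₊ t ⟨Nat.floor_le ht0, (Nat.lt_floor_add_one t).le⟩)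
    linarith [hlow k t ht, hcB ⌊t⌋₊]
  · have h := (htop k).eventually ((Real.isLittleO_pow_log_id_atTop (n := 2 * m)).bound one_pos)
    filter_upwards [h, eventually_ge_atTop (k + 1 : ℝ)] with t h1 ht
    have hfp j : 0 < f j t := (hcp j).trans_le (hfc j t)
    calc f (k + 1) t ^ m ≤ (Real.log (f k t) ^ 2) ^ m :=
          pow_le_pow_left₀ (hfp _).le (hle k t ht) m
      _ = Real.log (f k t) ^ (2 * m) := (pow_mul _ _ _).symm
      _ ≤ ‖Real.log (f k t) ^ (2 * m)‖ := le_abs_self _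
      _ ≤ 1 * ‖f k t‖ := h1
      _ = f k t := by rw [one_mul, Real.norm_of_nonneg (hfp k).le]

end HardyFields

/-! ### The main theorem -/

theorem mainTheorem5 (H : Subring HardyFields.RGerm)
    (hH : HardyFields.IsLiouvilleClosed H) (hR : HardyFields.ContainsReals H)
    (φ : HardyFields.RGerm) (hφ : φ ∈ HardyFields.continuousGerms)
    (hφH : ∀ h ∈ H, HardyFields.EventuallyLT h φ) :
    ∃ y ∈ HardyFields.smoothGerms ⊤, HardyFields.EventuallyLT φ y ∧
      ∃ K : Subring HardyFields.RGerm, HardyFields.GeneratesOver H y K := by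
  open HardyFields Filter in
  obtain ⟨a, F, hF, rfl⟩ := hφ
  -- `F` is replaced by the constant `F a` to the left of `a`; the germ is unchanged.
  have hψ : Continuous fun t => F (max a t) :=
    hF.comp_continuous (continuous_const.max continuous_id) fun t => le_max_left a t
  obtain ⟨f, hfs, hfd, hfF, hfm⟩ := exists_logDeriv_tower hψ
  have hF' k : ∀ᶠ t in atTop, F t < f k t := by
    filter_upwards [hfF k, eventually_ge_atTop a] with t h1 h2
    rwa [max_eq_right h2] at h1
  refine ⟨(f 0 : RGerm), ⟨0, f 0, (hfs 0).contDiffOn, rfl⟩, hF' 0, ?_⟩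
  refine exists_generatesOver (y := fun n => (f n : RGerm)) hH.toIsHardyField (fun n => ?_)
    (fun n => ?_) (fun n h hh => ?_) fun n m => hfm n m
  · exact coe_mem_differentiableGerms.2 ((hfd n).mono fun t h => h.differentiableAt)
  · exact Germ.coe_eq.2 ((hfd n).mono fun t h => h.deriv)
  · have := hφH h hh
    induction h using Germ.inductionOn with
    | _ h =>
      filter_upwards [show ∀ᶠ t in atTop, h t < F t from this, hF' n] with t h1 h2
      exact (h1.trans h2).le
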